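/- Let $(\mathcal{X},d_{\mathcal{X}})$ be a locally compact Polish space, $\mu$ a Borel probability measure on $\mathcal{X}$, and $\nu$ a Borel probability measure on $\mathbb{R}^d$. For a cost $c:\mathbb{R}^d\times\mathbb{R}^d\to\mathbb{R}_+$ and probability measures $\nu_1,\nu_2$ on $\mathbb{R}^d$, let $$\mathcal{T}_c(\nu_1,\nu_2)=\inf_{\pi\in\Pi(\nu_1,\nu_2)}\int_{\mathbb{R}^d\times\mathbb{R}^d}c(x,y)\,\mathrm{d}\pi(x,y)\in[0,+\infty],$$ where $\Pi(\nu_1,\nu_2)$ is the set of probability measures on $\mathbb{R}^d\times\mathbb{R}^d$ with first marginal $\nu_1$ and second marginal $\nu_2$. Say that a set $G$ of maps $\mathcal{X}\to\mathbb{R}^d$ is closed for the compact-open topology if there is a sequence $(\mathcal{K}_m)_{m\in\mathbb{N}}$ of compact subsets of $\mathcal{X}$ with $\bigcup_m\mathcal{K}_m=\mathcal{X}$ such that, for every sequence $(g_n)_{n\in\mathbb{N}}$ in $G$ for which, for every $m$, $(g_n|_{\mathcal{K}_m})_n$ converges uniformly to some function $g_{\mathcal{K}_m}:\mathcal{K}_m\to\mathbb{R}^d$,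 there is $g\in G$ with $g|_{\mathcal{K}_m}=g_{\mathcal{K}_m}$ for all $m$. **Theorem.** Let $c:\mathbb{R}^d\times\mathbb{R}^d\to\mathbb{R}_+$ be lower semicontinuous and let $L\ge 0$. Assume that: 1. there are a non-decreasing function $\eta:\mathbb{R}_+\to\mathbb{R}_+$ with $\eta(t)\to+\infty$ as $t\to+\infty$ and a number $\alpha\in\mathbb{R}$ such that $c(y,y')\ge\alpha+\eta(\|y-y'\|_2)$ for all $y,y'\in\mathbb{R}^d$, and $\int_{\mathbb{R}^d}\eta(\|y\|_2)\,\mathrm{d}\nu(y)<+\infty$; 2. $G$ is a set of $L$-Lipschitz maps from $(\mathcal{X},d_{\mathcal{X}})$ to $(\mathbb{R}^d,\|\cdot\|_2)$ that is closed for the compact-open topology; 3. there is $g\in G$ with $\mathcal{T}_c(g\#\mu,\nu)<+\infty$, where $g\#\mu$ is the image measure of $\mu$ by $g$. Then there is $g^*\in G$ such that $\mathcal{T}_c(g^*\#\mu,\nu)=\inf_{g\in G}\mathcal{T}_c(g\#\mu,\nu)$. -/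

import Mathlib

open Filter Topology MeasureTheory
open scoped NNReal ENNReal

/-- The set `Π(ν₁, ν₂)` of transport plans: probability measures on `Y × Z` with first marginal
`ν₁` and second marginal `ν₂`. -/
def transportPlans {Y Z : Type*} [MeasurableSpace Y] [MeasurableSpace Z]
    (ν₁ : Measure Y) (ν₂ : Measure Z) : Set (Measure (Y × Z)) :=
  {π | IsProbabilityMeasure π ∧ π.map Prod.fst = ν₁ ∧ π.map Prod.snd = ν₂}

/-- The optimal transport cost `𝒯_c(ν₁, ν₂) ∈ [0, +∞]` for the ground cost `c`. -/
noncomputable def transportCost {Y Z : Type*} [MeasurableSpace Y] [MeasurableSpace Z]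
    (c : Y × Z → ℝ≥0) (ν₁ : Measure Y) (ν₂ : Measure Z) : ℝ≥0∞ :=
  ⨅ π ∈ transportPlans ν₁ ν₂, ∫⁻ p, (c p : ℝ≥0∞) ∂π

/-- A class `G` of maps `X → E` is closed for the compact-open topology, in terms of sequences:
there are compact sets `K m` covering `X` such that, whenever the restrictions of a sequence of
elements of `G` converge uniformly on every `K m`, the limits are the restrictions of a single
element of `G`. -/
def ClosedForCompactOpen {X E : Type*} [TopologicalSpace X] [UniformSpace E]
    (G : Set (X → E)) : Prop :=
  ∃ K : ℕ → Set X, (∀ m, IsCompact (K m)) ∧ (⋃ m, K m) = Set.univ ∧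
    ∀ g : ℕ → X → E, (∀ n, g n ∈ G) →
      ∀ h : ∀ m, K m → E,
        (∀ m, TendstoUniformly (fun n (x : K m) => g n x) (h m) atTop) →
        ∃ f ∈ G, ∀ m, ∀ x : K m, f x = h m x

/-- The coercivity condition on a ground cost `c` relative to `ν`: `c(y, y') ≥ α + η(‖y - y'‖)`
for a real `α` and a non-decreasing `η : ℝ₊ → ℝ₊` which tends to `+∞` and for which
`∫ η(‖y‖) dν(y) < +∞`. -/
def CoerciveCost {E : Type*} [NormedAddCommGroup E] [MeasurableSpace E]
    (c : E × E → ℝ≥0) (ν : Measure E) : Prop :=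
  ∃ (η : ℝ≥0 → ℝ≥0) (α : ℝ), Monotone η ∧ Tendsto η atTop atTop ∧
    (∀ y y' : E, α + (η ‖y - y'‖₊ : ℝ) ≤ (c (y, y') : ℝ)) ∧
    ∫⁻ y, (η ‖y‖₊ : ℝ≥0∞) ∂ν < ∞

/-!
The minimiser is found by the direct method. A sequence `g n ∈ G` with plans
`π n ∈ Π(g n # μ, ν)` is chosen such that `∫ c dπ n` converges to the infimum.

* The coercivity of `c` gives a bound on `∫ η(‖g n x‖ / 2) dμ(x)` that is uniform in `n`
  (`lintegral_half_norm_le_of_mem_transportPlans`), because `‖y‖ / 2` is at most `‖y - y'‖` or at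
  most `‖y'‖`. As the maps `g n` share a Lipschitz constant and `η` tends to infinity, they are
  bounded at any given point (`exists_norm_le_of_lintegral_le`).
* By the Arzelà–Ascoli argument of `exists_subseq_tendsto_of_lipschitzWith`, a subsequence converges
  pointwise. Equicontinuity makes the convergence uniform on compact sets, and so the limit `f`
  is in `G` (`ClosedForCompactOpen.mem_of_tendsto`).
* The measures `g n # μ` converge weakly to `f # μ`. By Prokhorov's theorem a further subsequence
  of the plans converges weakly to a plan in `Π(f # μ, ν)` (`exists_subseq_tendsto_transportPlans`),
  and weak lower semicontinuity of `π ↦ ∫ c dπ` (`lintegral_le_liminf_of_lowerSemicontinuous`) shows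
  that the cost of this plan is at most the infimum.
-/

/-! ### Weak limits of transport plans -/

/-- The portmanteau inequality for a nonnegative lower semicontinuous integrand. -/
theorem lintegral_le_liminf_of_lowerSemicontinuous {Ω : Type*} [TopologicalSpace Ω]
    [MeasurableSpace Ω] [OpensMeasurableSpace Ω] [HasOuterApproxClosed Ω]
    {c : Ω → ℝ≥0} (hc : LowerSemicontinuous c)
    {P : ℕ → ProbabilityMeasure Ω} {Q : ProbabilityMeasure Ω} (h : Tendsto P atTop (𝓝 Q)) :
    ∫⁻ ω, (c ω : ℝ≥0∞) ∂(Q : Measure Ω) ≤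
      atTop.liminf fun n => ∫⁻ ω, (c ω : ℝ≥0∞) ∂(P n : Measure Ω) := by
  have hcm : Measurable c := hc.measurable
  have hopen : ∀ t : ℝ, IsOpen {ω | t < (c ω : ℝ)} := fun t =>
    (NNReal.continuous_coe.comp_lowerSemicontinuous hc NNReal.coe_mono).isOpen_preimage t
  have key : ∀ ρ : Measure Ω, ∫⁻ ω, (c ω : ℝ≥0∞) ∂ρ =
      ∫⁻ t in Set.Ioi (0 : ℝ), ρ {ω | t < (c ω : ℝ)} := fun ρ => by
    rw [← lintegral_eq_lintegral_meas_lt ρ (Eventually.of_forall fun ω => (c ω).coe_nonneg)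
      hcm.coe_nnreal_real.aemeasurable]
    simp
  simp_rw [key]
  refine (lintegral_mono fun t =>
    ProbabilityMeasure.le_liminf_measure_open_of_tendsto h (hopen t)).trans ?_
  exact lintegral_liminf_le fun n => Antitone.measurable fun s t hst =>
    measure_mono fun ω hω => lt_of_le_of_lt hst hω

/-- A weakly convergent sequence of probability measures on a complete separable metric space is
tight. -/
theorem isTightMeasureSet_range_of_tendsto {Y : Type*} [MetricSpace Y] [CompleteSpace Y]
    [SecondCountableTopology Y] [MeasurableSpace Y] [BorelSpace Y]
    {P : ℕ → ProbabilityMeasure Y} {Q : ProbabilityMeasure Y} (h : Tendsto P atTop (𝓝 Q)) :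
    IsTightMeasureSet (Set.range fun n => (P n : Measure Y)) := by
  have hcomp : IsCompact (closure (Set.range P)) :=
    h.isCompact_insert_range.closure_of_subset (Set.subset_insert _ _)
  refine (isTightMeasureSet_of_isCompact_closure hcomp).subset ?_
  rintro _ ⟨n, rfl⟩
  exact ⟨P n, ⟨n, rfl⟩, rfl⟩

/-- Plans whose two marginals converge weakly have a subsequence which converges weakly to a plan
between the limits of the marginals. -/
theorem exists_subseq_tendsto_transportPlans {Y Z : Type*}
    [MetricSpace Y] [CompleteSpace Y] [SecondCountableTopology Y]
    [MeasurableSpace Y] [BorelSpace Y]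
    [MetricSpace Z] [CompleteSpace Z] [SecondCountableTopology Z]
    [MeasurableSpace Z] [BorelSpace Z]
    {P : ℕ → ProbabilityMeasure Y} {P' : ProbabilityMeasure Y} (hP : Tendsto P atTop (𝓝 P'))
    {Q : ℕ → ProbabilityMeasure Z} {Q' : ProbabilityMeasure Z} (hQ : Tendsto Q atTop (𝓝 Q'))
    {π : ℕ → ProbabilityMeasure (Y × Z)}
    (hπ : ∀ n, (π n : Measure (Y × Z)) ∈ transportPlans (P n : Measure Y) (Q n : Measure Z)) :
    ∃ (π' : ProbabilityMeasure (Y × Z)) (φ : ℕ → ℕ), StrictMono φ ∧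
      Tendsto (π ∘ φ) atTop (𝓝 π') ∧
      (π' : Measure (Y × Z)) ∈ transportPlans (P' : Measure Y) (Q' : Measure Z) := by
  have htight : IsTightMeasureSet
      {((ρ : ProbabilityMeasure (Y × Z)) : Measure (Y × Z)) | ρ ∈ Set.range π} := by
    apply IsTightMeasureSet.prodMk
    · refine (isTightMeasureSet_range_of_tendsto hP).subset ?_
      rintro _ ⟨_, ⟨_, ⟨n, rfl⟩, rfl⟩, rfl⟩
      exact ⟨n, (hπ n).2.1.symm⟩
    · refine (isTightMeasureSet_range_of_tendsto hQ).subset ?_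
      rintro _ ⟨_, ⟨_, ⟨n, rfl⟩, rfl⟩, rfl⟩
      exact ⟨n, (hπ n).2.2.symm⟩
  obtain ⟨π', -, φ, hφ, hlim⟩ := (isCompact_closure_of_isTightMeasureSet htight).tendsto_subseq
    (fun n => subset_closure (Set.mem_range_self n))
  refine ⟨π', φ, hφ, hlim, inferInstance, ?_, ?_⟩
  · have h1 := ProbabilityMeasure.tendsto_map_of_tendsto_of_continuous _ _ hlim continuous_fst
    have h2 : ∀ n, ((π ∘ φ) n).map continuous_fst.measurable.aemeasurable = (P ∘ φ) n :=
      fun n => Subtype.ext (hπ (φ n)).2.1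
    exact congrArg ProbabilityMeasure.toMeasure
      (tendsto_nhds_unique (h1.congr h2) (hP.comp hφ.tendsto_atTop))
  · have h1 := ProbabilityMeasure.tendsto_map_of_tendsto_of_continuous _ _ hlim continuous_snd
    have h2 : ∀ n, ((π ∘ φ) n).map continuous_snd.measurable.aemeasurable = (Q ∘ φ) n :=
      fun n => Subtype.ext (hπ (φ n)).2.2
    exact congrArg ProbabilityMeasure.toMeasure
      (tendsto_nhds_unique (h1.congr h2) (hQ.comp hφ.tendsto_atTop))

/-! ### Consequences of coercivity -/

/-- A coercive cost controls the moments of the first marginal of a plan by the cost of the plan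
and the moments of the second marginal. -/
theorem lintegral_half_norm_le_of_mem_transportPlans {E : Type*} [NormedAddCommGroup E]
    [MeasurableSpace E] [BorelSpace E] {c : E × E → ℝ≥0} {η : ℝ≥0 → ℝ≥0} {α : ℝ}
    (hη : Monotone η) (hc : ∀ y y' : E, α + (η ‖y - y'‖₊ : ℝ) ≤ (c (y, y') : ℝ))
    {ν₁ ν₂ : Measure E} {π : Measure (E × E)} (hπ : π ∈ transportPlans ν₁ ν₂) :
    ∫⁻ y, (η (‖y‖₊ / 2) : ℝ≥0∞) ∂ν₁ ≤
      ∫⁻ p, (c p : ℝ≥0∞) ∂π + (‖α‖₊ + ∫⁻ y, (η ‖y‖₊ : ℝ≥0∞) ∂ν₂) := by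
  obtain ⟨hprob, h1, h2⟩ := hπ
  have hm1 : Measurable fun y : E => (η (‖y‖₊ / 2) : ℝ≥0∞) :=
    (hη.measurable.comp (measurable_nnnorm.div_const 2)).coe_nnreal_ennreal
  have hm2 : Measurable fun y : E => (η ‖y‖₊ : ℝ≥0∞) :=
    (hη.measurable.comp measurable_nnnorm).coe_nnreal_ennreal
  have hpt : ∀ p : E × E, η (‖p.1‖₊ / 2) ≤ c p + (‖α‖₊ + η ‖p.2‖₊) := by
    rintro ⟨y, y'⟩
    have hdiff : η ‖y - y'‖₊ ≤ c (y, y') + ‖α‖₊ := by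
      have h3 := hc y y'
      have h4 := neg_abs_le α
      rw [← NNReal.coe_le_coe, NNReal.coe_add, coe_nnnorm, Real.norm_eq_abs]
      linarith
    have hmax : ‖y‖₊ / 2 ≤ max ‖y - y'‖₊ ‖y'‖₊ := by
      have htri : ‖y‖ ≤ ‖y - y'‖ + ‖y'‖ := by simpa using norm_add_le (y - y') y'
      rw [← NNReal.coe_le_coe]
      push_cast
      have h5 := le_max_left ‖y - y'‖ ‖y'‖
      have h6 := le_max_right ‖y - y'‖ ‖y'‖
      linarith
    calc η (‖y‖₊ / 2) ≤ max (η ‖y - y'‖₊) (η ‖y'‖₊) := (hη hmax).trans_eq (hη.map_max)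
      _ ≤ η ‖y - y'‖₊ + η ‖y'‖₊ := max_le_add_of_nonneg zero_le zero_le
      _ ≤ c (y, y') + ‖α‖₊ + η ‖y'‖₊ := by gcongr
      _ = _ := add_assoc _ _ _
  rw [← h1, ← h2, lintegral_map hm1 measurable_fst, lintegral_map hm2 measurable_snd]
  calc ∫⁻ p, (η (‖p.1‖₊ / 2) : ℝ≥0∞) ∂π
      ≤ ∫⁻ p, ((c p : ℝ≥0∞) + (‖α‖₊ + (η ‖p.2‖₊ : ℝ≥0∞))) ∂π :=
        lintegral_mono fun p => by simpa using ENNReal.coe_le_coe.2 (hpt p)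
    _ = _ := by
        have hm3 : Measurable fun p : E × E => (η ‖p.2‖₊ : ℝ≥0∞) := hm2.comp measurable_snd
        rw [lintegral_add_right _ (hm3.const_add _), lintegral_add_left measurable_const,
          lintegral_const, measure_univ, mul_one]

/-- Maps with a common Lipschitz constant and a common bound on `∫ η(‖g‖ / 2) dμ`, where `η` tends
to infinity, are uniformly bounded at each point. -/
theorem exists_norm_le_of_lintegral_le {X E : Type*} [PseudoMetricSpace X] [MeasurableSpace X]
    [OpensMeasurableSpace X] [NormedAddCommGroup E] (μ : Measure X) [NeZero μ]
    {η : ℝ≥0 → ℝ≥0} (hη : Monotone η) (hη' : Tendsto η atTop atTop) (L : ℝ≥0)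
    {C : ℝ≥0∞} (hC : C ≠ ∞) (x₀ : X) :
    ∃ r : ℝ, ∀ g : X → E, LipschitzWith L g →
      ∫⁻ x, (η (‖g x‖₊ / 2) : ℝ≥0∞) ∂μ ≤ C → ‖g x₀‖ ≤ r := by
  obtain ⟨n, hn⟩ : ∃ n : ℕ, μ (Metric.closedBall x₀ n) ≠ 0 := by
    by_contra! h
    refine NeZero.ne μ (Measure.measure_univ_eq_zero.1 ?_)
    rw [← Metric.iUnion_closedBall_nat x₀]
    exact measure_iUnion_null h
  set B := Metric.closedBall x₀ (n : ℝ)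
  obtain ⟨t, ht⟩ : ∃ t : ℝ≥0, C / μ B < η t := by
    have hlt : C / μ B < ∞ := ENNReal.div_lt_top hC hn
    obtain ⟨t, ht⟩ := (hη'.eventually_gt_atTop (C / μ B).toNNReal).exists
    refine ⟨t, ?_⟩
    rw [← ENNReal.coe_toNNReal hlt.ne]
    exact_mod_cast ht
  -- If `‖g x₀‖ > 2 * t + L * n`, then `‖g x‖ / 2 ≥ t` on the ball `B`, of radius `n`.
  refine ⟨2 * t + L * n, fun g hg hint => ?_⟩
  by_contra! hlt
  have hB : ∀ x ∈ B, (η t : ℝ≥0∞) ≤ η (‖g x‖₊ / 2) := fun x hx => by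
    refine ENNReal.coe_le_coe.2 (hη ?_)
    have h1 : dist (g x₀) (g x) ≤ L * n := by
      refine (hg.dist_le_mul x₀ x).trans ?_
      rw [dist_comm]
      exact mul_le_mul_of_nonneg_left (Metric.mem_closedBall.1 hx) L.coe_nonneg
    have h2 : ‖g x₀‖ ≤ dist (g x₀) (g x) + ‖g x‖ := by
      simpa [dist_eq_norm] using norm_add_le (g x₀ - g x) (g x)
    rw [← NNReal.coe_le_coe]
    push_cast
    linarith
  have hle : η t * μ B ≤ C := by
    refine le_trans ?_ hint
    rw [← setLIntegral_const]
    exact (setLIntegral_mono' Metric.isClosed_closedBall.measurableSet hB).trans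
      (setLIntegral_le_lintegral _ _)
  exact absurd (ENNReal.le_div_iff_mul_le (Or.inl hn) (Or.inr hC) |>.2 hle) (not_le.2 ht)

/-! ### Compactness of Lipschitz maps -/

/-- A sequence of maps with a common Lipschitz constant from a separable metric space to a proper
space, bounded at one point, has a pointwise convergent subsequence. -/
theorem exists_subseq_tendsto_of_lipschitzWith {X E : Type*} [PseudoMetricSpace X]
    [TopologicalSpace.SeparableSpace X] [NormedAddCommGroup E] [ProperSpace E] {L : ℝ≥0}
    {g : ℕ → X → E} (hg : ∀ n, LipschitzWith L (g n)) {x₀ : X} {r : ℝ}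
    (hr : ∀ n, ‖g n x₀‖ ≤ r) :
    ∃ (f : X → E) (φ : ℕ → ℕ), StrictMono φ ∧ LipschitzWith L f ∧
      ∀ x, Tendsto (fun n => g (φ n) x) atTop (𝓝 (f x)) := by
  -- By Tychonoff's theorem there is a pointwise limit `f` along an ultrafilter.
  have hmem : ∀ n, g n ∈ Set.univ.pi fun x => Metric.closedBall (0 : E) (r + L * dist x x₀) := by
    intro n x _
    have h1 : ‖g n x‖ ≤ ‖g n x₀‖ + dist (g n x) (g n x₀) := by
      rw [dist_eq_norm]
      simpa using norm_add_le (g n x₀) (g n x - g n x₀)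
    rw [mem_closedBall_zero_iff]
    linarith [hr n, (hg n).dist_le_mul x x₀]
  obtain ⟨f, -, hf⟩ := (isCompact_univ_pi fun x =>
    isCompact_closedBall (0 : E) (r + L * dist x x₀)).ultrafilter_le_nhds
      ((hyperfilter ℕ).map g)
      (le_principal_iff.2 (Ultrafilter.mem_map.2 (Eventually.of_forall hmem)))
  have hfx : ∀ x, Tendsto (fun n => g n x) (hyperfilter ℕ) (𝓝 (f x)) := tendsto_pi_nhds.1 hf
  have hfL : LipschitzWith L f := LipschitzWith.of_dist_le_mul fun x y =>
    le_of_tendsto ((hfx x).dist (hfx y)) (Eventually.of_forall fun n => (hg n).dist_le_mul x y)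
  have : Nonempty X := ⟨x₀⟩
  -- On a countable dense set, a subsequence converges to the same `f`: the product is countable.
  have hclu : MapClusterPt (fun k => f (TopologicalSpace.denseSeq X k)) atTop
      (fun n k => g n (TopologicalSpace.denseSeq X k)) :=
    (Tendsto.mapClusterPt (tendsto_pi_nhds.2 fun k => hfx _)).mono Nat.hyperfilter_le_atTop
  obtain ⟨φ, hφ, hlim⟩ := hclu.tendsto_subseq
  refine ⟨f, φ, hφ, hfL, fun x => ?_⟩
  have hcl : IsClosed {x | Tendsto (fun n => g (φ n) x) atTop (𝓝 (f x))} :=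
    Equicontinuous.isClosed_setOfPred_tendsto (LipschitzWith.uniformEquicontinuous
      (fun n => g (φ n)) L fun n => hg (φ n)).equicontinuous hfL.continuous
  exact hcl.closure_subset_iff.2 (Set.range_subset_iff.2 (tendsto_pi_nhds.1 hlim))
    (TopologicalSpace.denseRange_denseSeq X x)

/-- Pointwise limits of equi-Lipschitz sequences stay in a class closed for the compact-open
topology, since such sequences converge uniformly on compact sets. -/
theorem ClosedForCompactOpen.mem_of_tendsto {X E : Type*} [PseudoMetricSpace X]
    [PseudoMetricSpace E] {G : Set (X → E)} (hG : ClosedForCompactOpen G)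
    {L : ℝ≥0} {g : ℕ → X → E} (hgG : ∀ n, g n ∈ G) (hg : ∀ n, LipschitzWith L (g n))
    {f : X → E} (hf : ∀ x, Tendsto (fun n => g n x) atTop (𝓝 (f x))) : f ∈ G := by
  obtain ⟨K, hK, hcov, hlim⟩ := hG
  obtain ⟨f', hf'G, hf'⟩ := hlim g hgG (fun m x => f x) fun m => by
    have : CompactSpace (K m) := isCompact_iff_compactSpace.1 (hK m)
    have heq : Equicontinuous fun n (x : K m) => g n x :=
      (LipschitzWith.uniformEquicontinuous _ L fun n =>
        (mul_one L ▸ (hg n).comp (LipschitzWith.subtype_val (K m)) :)).equicontinuous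
    exact UniformFun.tendsto_iff_tendstoUniformly.1
      ((heq.tendsto_uniformFun_iff_pi _ (fun x : K m => f x)).2
        (tendsto_pi_nhds.2 fun x => hf x))
  have hff : f' = f := funext fun x => by
    obtain ⟨m, hm⟩ := Set.mem_iUnion.1 (hcov ▸ Set.mem_univ x)
    exact hf' m ⟨x, hm⟩
  exact hff ▸ hf'G

/-! ### Existence of a minimiser -/

theorem mainTheorem1
    {X : Type*} [MetricSpace X] [LocallyCompactSpace X] [PolishSpace X]
    [MeasurableSpace X] [BorelSpace X] {d : ℕ}
    (c : EuclideanSpace ℝ (Fin d) × EuclideanSpace ℝ (Fin d) → ℝ≥0)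
    (hc : LowerSemicontinuous c)
    (μ : Measure X) [IsProbabilityMeasure μ]
    (ν : Measure (EuclideanSpace ℝ (Fin d))) [IsProbabilityMeasure ν]
    (hcoercive : CoerciveCost c ν)
    (L : ℝ≥0) (G : Set (X → EuclideanSpace ℝ (Fin d)))
    (hLip : ∀ g ∈ G, LipschitzWith L g)
    (hclosed : ClosedForCompactOpen G)
    (hfinite : ∃ g ∈ G, transportCost c (μ.map g) ν < ∞) :
    ∃ g ∈ G, IsMinOn (fun f => transportCost c (μ.map f) ν) G g := by
  obtain ⟨η, α, hη, hη', hcη, hην⟩ := hcoercive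
  obtain ⟨x₀⟩ : Nonempty X := nonempty_of_isProbabilityMeasure μ
  set I : ℝ≥0∞ := ⨅ g ∈ G, transportCost c (μ.map g) ν with hI
  have hItop : I ≠ ∞ := by
    obtain ⟨g, hgG, hg⟩ := hfinite
    exact ((iInf₂_le g hgG).trans_lt hg).ne
  have hseq : ∀ n : ℕ, ∃ g ∈ G, ∃ π ∈ transportPlans (μ.map g) ν,
      ∫⁻ p, (c p : ℝ≥0∞) ∂π < I + (n + 1 : ℝ≥0∞)⁻¹ := fun n => by
    have hlt : I < I + (n + 1 : ℝ≥0∞)⁻¹ :=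
      ENNReal.lt_add_right hItop (ENNReal.inv_ne_zero.2 (by finiteness))
    simpa only [hI, transportCost, iInf_lt_iff, exists_prop] using hlt
  choose g hgG π hπ hcost using hseq
  have hgL : ∀ n, LipschitzWith L (g n) := fun n => hLip _ (hgG n)
  have hC : I + 1 + (‖α‖₊ + ∫⁻ y, (η ‖y‖₊ : ℝ≥0∞) ∂ν) ≠ ∞ := by finiteness
  obtain ⟨r, hr⟩ := exists_norm_le_of_lintegral_le (E := EuclideanSpace ℝ (Fin d)) μ hη hη' L hC x₀
  have hgr : ∀ n, ‖g n x₀‖ ≤ r := fun n => by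
    refine hr _ (hgL n) ?_
    have hmoment := lintegral_half_norm_le_of_mem_transportPlans hη hcη (hπ n)
    have hm : Measurable fun y : EuclideanSpace ℝ (Fin d) => (η (‖y‖₊ / 2) : ℝ≥0∞) :=
      (hη.measurable.comp (measurable_nnnorm.div_const 2)).coe_nnreal_ennreal
    rw [lintegral_map hm (hgL n).continuous.measurable] at hmoment
    refine hmoment.trans (add_le_add_left ((hcost n).le.trans ?_) _)
    gcongr
    exact ENNReal.inv_le_one.2 le_add_self
  obtain ⟨f, φ, hφ, hfL, hf⟩ := exists_subseq_tendsto_of_lipschitzWith hgL hgr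
  have hfG : f ∈ G := hclosed.mem_of_tendsto (fun n => hgG (φ n)) (fun n => hgL (φ n)) hf
  have hweak := (tendstoInDistribution_of_ae_tendsto (μ' := μ)
    (fun n => (hgL (φ n)).continuous.aemeasurable) hfL.continuous.aemeasurable
    (Eventually.of_forall hf)).tendsto
  have hπprob : ∀ n, IsProbabilityMeasure (π n) := fun n => (hπ n).1
  let ν' : ProbabilityMeasure (EuclideanSpace ℝ (Fin d)) := ⟨ν, inferInstance⟩
  obtain ⟨π', ψ, hψ, hπlim, hπ'⟩ := exists_subseq_tendsto_transportPlans hweak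
    (tendsto_const_nhds (x := ν'))
    (π := fun n => ⟨π (φ n), hπprob _⟩) (fun n => hπ (φ n))
  have hbound : Tendsto (fun n : ℕ => I + ((φ (ψ n) : ℕ) + 1 : ℝ≥0∞)⁻¹) atTop (𝓝 I) := by
    have h0 : Tendsto (fun n : ℕ => ((n : ℝ≥0∞) + 1)⁻¹) atTop (𝓝 0) := by
      have := (tendsto_add_atTop_iff_nat 1).2 ENNReal.tendsto_inv_nat_nhds_zero
      simpa using this
    simpa using tendsto_const_nhds.add (h0.comp (hφ.comp hψ).tendsto_atTop)
  have hmin : transportCost c (μ.map f) ν ≤ I :=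
    calc transportCost c (μ.map f) ν ≤ ∫⁻ p, (c p : ℝ≥0∞) ∂(π' : Measure _) := iInf₂_le _ hπ'
      _ ≤ atTop.liminf fun n => ∫⁻ p, (c p : ℝ≥0∞) ∂(π (φ (ψ n))) :=
          lintegral_le_liminf_of_lowerSemicontinuous hc hπlim
      _ ≤ atTop.liminf fun n => I + ((φ (ψ n) : ℕ) + 1 : ℝ≥0∞)⁻¹ :=
          liminf_le_liminf (Eventually.of_forall fun n => (hcost _).le)
      _ = I := hbound.liminf_eq
  exact ⟨f, hfG, fun g hg => hmin.trans (iInf₂_le g hg)⟩
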